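/- A finite group $G$ is *exponent-critical* if its exponent $\exp(G)$ is not the least common multiple of the exponents of its proper non-abelian subgroups (the empty least common multiple being $1$). For a prime $p$, a non-abelian exponent-critical $p$-group is of *type $\mathcal A$* if exactly one of its maximal subgroups is abelian. Let $p$ be a prime and, for an integer $m\ge 2$, let $W=\langle a_0\rangle\times\langle a_1\rangle\times\cdots\times\langle a_{p-1}\rangle$ be the abelian group in which $a_0$ has order $p^m$ and $a_i$ has order $p^{m-1}$ for $1\le i\le p-1$. Let $\phi$ be the automorphism of $W$ with $\phi(a_i)=a_ia_{i+1}$ for $0\le i\le p-2$ and $\phi(a_{p-1})=a_{p-1}\prod_{j=1}^{p-1}a_j^{-\binom pj}$. Let $U=W\rtimes\langle b_0\rangle$, where $b_0$ has order $p^{m-1}$ and $b_0^{-1}wb_0=\phi(w)$ for all $w\in W$. Let $D\le U$ be the subgroup generated by $a_0^{p^{m-1}}a_{p-1}^{p^{m-2}}$, and let $\mathcal N$ be the set of normal subgroups $N$ of $U$ such that $$D\le N\le\Phi(U),\qquad N\cap\langle a_0\rangle=\{1\},\qquad U'\not\le N,$$ where $\Phi(U)$ is the Frattini subgroup and $U'$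 the derived subgroup of $U$. **Theorem E.** (i) Let $m\ge 0$ and let $P$ be a (non-abelian) exponent-critical $p$-group of exponent $p^m$ and type $\mathcal A$. Then $m\ge 2$, and $P$ is isomorphic to $U/N$ for some $N\in\mathcal N$. (ii) Let $m\ge 2$. For every $N\in\mathcal N$, the group $U/N$ is a non-abelian exponent-critical $p$-group of exponent $p^m$. (iii) There are no (non-abelian) exponent-critical $2$-groups of exponent $2^2$ and type $\mathcal A$. If $m\ge 2$, and $p$ is odd or $m\ge 3$, then for every $N\in\mathcal N$ the group $U/N$ is a non-abelian exponent-critical $p$-group of exponent $p^m$ and type $\mathcal A$. -/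

import Mathlib

/-- A finite group is exponent-critical if its exponent is not the least common multiple of the
exponents of its proper non-abelian subgroups (the empty least common multiple being `1`). -/
def IsExponentCritical (G : Type*) [Group G] : Prop :=
  ∃ _ : Finite G, Monoid.exponent G ≠
    (Set.toFinite {H : Subgroup G | H ≠ ⊤ ∧ ¬ IsMulCommutative H}).toFinset.lcm
      (fun H => Monoid.exponent H)

/-- The group has exactly one maximal subgroup that is abelian. (The term "type A" is used for
non-abelian exponent-critical `p`-groups with this property.) -/
def IsTypeA (G : Type*) [Group G] : Prop :=
  ∃! M : Subgroup G, IsCoatom M ∧ IsMulCommutative M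

namespace TypeA

/-- The order of the generator `a i` of `W`: `p ^ m` for `i = 0`, and `p ^ (m - 1)` otherwise. -/
def ord (p m : ℕ) (i : Fin p) : ℕ := if i.val = 0 then p ^ m else p ^ (m - 1)

/-- The group `W`, written additively: the direct product of the cyclic groups of order
`ord p m i`. -/
abbrev AddW (p m : ℕ) : Type := ∀ i : Fin p, ZMod (ord p m i)

/-- The `i`-th generator of `W`, written additively. -/
def gen (p m : ℕ) (i : Fin p) : AddW p m := Pi.single i 1

/-- The prescribed image of the `i`-th generator, written additively. -/
def img (p m : ℕ) (i : Fin p) : AddW p m :=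
  if h : i.val + 1 < p then gen p m i + gen p m ⟨i.val + 1, h⟩
  else gen p m i + ∑ j : Fin p with j.val ≠ 0, -(p.choose j.val • gen p m j)

theorem ord_nsmul_gen (p m : ℕ) (i : Fin p) : ord p m i • gen p m i = 0 := by
  rw [gen, ← Pi.single_smul, nsmul_one, ZMod.natCast_self, Pi.single_zero]

theorem ord_dvd (p m : ℕ) (i j : Fin p) (hj : j.val ≠ 0) : ord p m j ∣ ord p m i := by
  unfold ord
  rw [if_neg hj]
  split_ifs
  · exact pow_dvd_pow _ (Nat.sub_le _ _)
  · exact dvd_rfl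

theorem ord_nsmul_gen' (p m : ℕ) (i j : Fin p) (hj : j.val ≠ 0) :
    ord p m i • gen p m j = 0 := by
  obtain ⟨c, hc⟩ := ord_dvd p m i j hj
  rw [hc, mul_comm, mul_nsmul', ord_nsmul_gen, nsmul_zero]

theorem ord_nsmul_img (p m : ℕ) (i : Fin p) : ord p m i • img p m i = 0 := by
  unfold img
  split_ifs with h
  · rw [nsmul_add, ord_nsmul_gen, ord_nsmul_gen' _ _ _ _ (by simp), add_zero]
  · rw [nsmul_add, ord_nsmul_gen, zero_add, Finset.smul_sum]
    refine Finset.sum_eq_zero fun j hj => ?_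
    rw [smul_neg, smul_comm, ord_nsmul_gen' _ _ _ _ (Finset.mem_filter.1 hj).2, smul_zero,
      neg_zero]

/-- The endomorphism `φ` of `W` with `φ (a i) = img i`, written additively. -/
def addPhi (p m : ℕ) : Module.End ℤ (AddW p m) :=
  ∑ i : Fin p, (ZMod.lift (ord p m i) ⟨zmultiplesHom _ (img p m i), by
    simpa using ord_nsmul_img p m i⟩).toIntLinearMap ∘ₗ LinearMap.proj i

theorem addPhi_gen (p m : ℕ) (i : Fin p) : addPhi p m (gen p m i) = img p m i := by
  unfold addPhi
  rw [LinearMap.sum_apply, Finset.sum_eq_single i]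
  · have h := ZMod.lift_coe (ord p m i) ⟨zmultiplesHom _ (img p m i), by
      simpa using ord_nsmul_img p m i⟩ 1
    simpa [gen] using h
  · intro j _ hj
    simp [gen, Pi.single_eq_of_ne hj]
  · simp

theorem end_ext (p m : ℕ) (f g : Module.End ℤ (AddW p m))
    (h : ∀ i, f (gen p m i) = g (gen p m i)) : f = g := by
  refine LinearMap.pi_ext fun i x => ?_
  obtain ⟨k, rfl⟩ := ZMod.intCast_surjective x
  have : (Pi.single i (k : ZMod (ord p m i)) : AddW p m) = k • gen p m i := by
    rw [gen, ← Pi.single_smul, zsmul_one]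
  rw [this, map_zsmul, map_zsmul, h]

theorem addPhi_pow_prime (p m : ℕ) [Fact p.Prime] : addPhi p m ^ p = 1 := by
  have hp : 0 < p := (Fact.out : p.Prime).pos
  obtain ⟨k, hk⟩ : ∃ k : Module.End ℤ (AddW p m), addPhi p m = k + 1 :=
    ⟨addPhi p m - 1, by simp⟩
  have hkg : ∀ x, k x = addPhi p m x - x := fun x => by
    rw [hk, LinearMap.add_apply]; simp
  have hiter : ∀ j (hj : j < p), (k ^ j) (gen p m ⟨0, hp⟩) = gen p m ⟨j, hj⟩ := by
    intro j
    induction j with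
    | zero => intro _; simp
    | succ j ih =>
      intro hj
      rw [pow_succ', Module.End.mul_apply, ih (by omega), hkg, addPhi_gen, img, dif_pos hj,
        add_sub_cancel_left]
  have htop : (k ^ p) (gen p m ⟨0, hp⟩) =
      -∑ j : Fin p with j.val ≠ 0, p.choose j.val • gen p m j := by
    have hpp : k ^ p = k * k ^ (p - 1) := by rw [← pow_succ', Nat.sub_add_cancel hp]
    rw [hpp, Module.End.mul_apply, hiter _ (by omega), hkg, addPhi_gen, img,
      dif_neg (by simp; omega), add_sub_cancel_left, Finset.sum_neg_distrib]
  have h0 : (addPhi p m ^ p) (gen p m ⟨0, hp⟩) = gen p m ⟨0, hp⟩ := by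
    have hsum : ∑ j : Fin p, p.choose j.val • gen p m j = gen p m ⟨0, hp⟩ +
        ∑ j : Fin p with j.val ≠ 0, p.choose j.val • gen p m j := by
      rw [← Finset.sum_filter_add_sum_filter_not Finset.univ (fun j : Fin p => j.val = 0)]
      congr 1
      rw [Finset.sum_eq_single ⟨0, hp⟩]
      · simp
      · intro b hb hb'
        exact absurd (Fin.ext (Finset.mem_filter.1 hb).2) hb'
      · simp
    rw [hk, (Commute.one_right k).add_pow, LinearMap.sum_apply,
      Finset.sum_range_succ, Finset.sum_range]
    have hterm : ∀ j : ℕ, (k ^ j * 1 ^ (p - j) * (p.choose j : Module.End ℤ (AddW p m)))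
        (gen p m ⟨0, hp⟩) = p.choose j • (k ^ j) (gen p m ⟨0, hp⟩) := by
      intro j
      rw [one_pow, mul_one, Module.End.mul_apply, Module.End.natCast_apply, map_nsmul]
    simp only [hterm]
    rw [Finset.sum_congr rfl fun j _ => by rw [hiter j.val j.isLt], hsum, htop, Nat.choose_self,
      one_nsmul, add_neg_cancel_right]
  refine end_ext p m _ _ fun i => ?_
  have hall : ∀ j (hj : j < p), (addPhi p m ^ p) (gen p m ⟨j, hj⟩) = gen p m ⟨j, hj⟩ := by
    intro j
    induction j with
    | zero => intro _; exact h0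
    | succ j ih =>
      intro hj
      have hs : gen p m ⟨j + 1, hj⟩ =
          addPhi p m (gen p m ⟨j, by omega⟩) - gen p m ⟨j, by omega⟩ := by
        rw [addPhi_gen, img, dif_pos hj, add_sub_cancel_left]
      rw [hs, map_sub, ih (by omega), ← Module.End.mul_apply, ← pow_succ, pow_succ',
        Module.End.mul_apply, ih (by omega)]
  simpa using hall i.val i.isLt

theorem addPhi_pow (p m : ℕ) [Fact p.Prime] : addPhi p m ^ p ^ (m - 1) = 1 := by
  by_cases hm : 2 ≤ m
  · obtain ⟨c, hc⟩ : p ∣ p ^ (m - 1) := dvd_pow_self p (by omega)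
    rw [hc, pow_mul, addPhi_pow_prime, one_pow]
  · have hg : ∀ j : Fin p, j.val ≠ 0 → gen p m j = 0 := fun j hj => by
      have h := ord_nsmul_gen p m j
      rwa [ord, if_neg hj, show m - 1 = 0 by omega, pow_zero, one_smul] at h
    have : addPhi p m = 1 := end_ext p m _ _ fun i => by
      rw [addPhi_gen, img, Module.End.one_apply]
      split_ifs with h
      · rw [hg ⟨i.val + 1, h⟩ (Nat.succ_ne_zero _), add_zero]
      · rw [Finset.sum_eq_zero fun j hj => by
          rw [hg _ (Finset.mem_filter.1 hj).2, smul_zero, neg_zero], add_zero]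
    rw [this, one_pow]

/-- The abelian group `W`. -/
abbrev W (p m : ℕ) : Type := Multiplicative (AddW p m)

/-- The automorphism `φ` of `W`. -/
def phi (p m : ℕ) [Fact p.Prime] : MulAut (W p m) :=
  (MulAutMultiplicative (AddW p m)).symm
    { toFun := addPhi p m
      invFun := ⇑(addPhi p m ^ (p - 1))
      left_inv := fun x => by
        rw [← Module.End.mul_apply, ← pow_succ,
          Nat.sub_add_cancel (Fact.out : p.Prime).one_le, addPhi_pow_prime,
          Module.End.one_apply]
      right_inv := fun x => by
        rw [← Module.End.mul_apply, ← pow_succ',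
          Nat.sub_add_cancel (Fact.out : p.Prime).one_le, addPhi_pow_prime,
          Module.End.one_apply]
      map_add' := map_add _ }

theorem phi_pow_apply (p m : ℕ) [Fact p.Prime] (k : ℕ) (w : W p m) :
    (phi p m ^ k) w = Multiplicative.ofAdd ((addPhi p m ^ k) w.toAdd) := by
  induction k generalizing w with
  | zero => simp
  | succ k ih => rw [pow_succ, MulAut.mul_apply, ih, pow_succ, Module.End.mul_apply]; rfl

theorem phi_pow (p m : ℕ) [Fact p.Prime] : phi p m ^ p ^ (m - 1) = 1 := by
  ext1 w
  rw [phi_pow_apply, addPhi_pow]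
  rfl

/-- The cyclic group `⟨b₀⟩` of order `p ^ (m - 1)`. -/
abbrev B (p m : ℕ) : Type := Multiplicative (ZMod (p ^ (m - 1)))

/-- The action of `⟨b₀⟩` on `W` in which the generator `b₀` acts as `φ⁻¹`. In Mathlib's
semidirect product the action of `b` is `w ↦ b * w * b⁻¹`, so this gives
`b₀⁻¹ * w * b₀ = φ w`. -/
def act (p m : ℕ) [Fact p.Prime] : B p m →* MulAut (W p m) :=
  AddMonoidHom.toMultiplicativeLeft (ZMod.lift (p ^ (m - 1))
    ⟨zmultiplesHom (Additive (MulAut (W p m))) (Additive.ofMul (phi p m)⁻¹), by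
      rw [zmultiplesHom_apply, ← ofMul_zpow, zpow_natCast, inv_pow, phi_pow, inv_one,
        ofMul_one]⟩)

/-- The semidirect product `U = W ⋊ ⟨b₀⟩`. -/
abbrev U (p m : ℕ) [Fact p.Prime] : Type := W p m ⋊[act p m] B p m

/-- The generator `a i` of `W`, as an element of `U`. -/
def a (p m : ℕ) [Fact p.Prime] (i : Fin p) : U p m :=
  SemidirectProduct.inl (Multiplicative.ofAdd (gen p m i))

/-- The generator `b₀`, as an element of `U`. -/
def b₀ (p m : ℕ) [Fact p.Prime] : U p m :=
  SemidirectProduct.inr (Multiplicative.ofAdd 1)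

/-- The generator `a₀`, as an element of `U`. -/
def a₀ (p m : ℕ) [Fact p.Prime] : U p m := a p m ⟨0, (Fact.out : p.Prime).pos⟩

/-- The generator `a_{p-1}`, as an element of `U`. -/
def aLast (p m : ℕ) [Fact p.Prime] : U p m :=
  a p m ⟨p - 1, Nat.sub_lt (Fact.out : p.Prime).pos one_pos⟩

/-- The subgroup `D` of `U` generated by `a₀ ^ (p ^ (m - 1)) * a_{p-1} ^ (p ^ (m - 2))`; it is used
for `2 ≤ m`. -/
def D (p m : ℕ) [Fact p.Prime] : Subgroup (U p m) :=
  Subgroup.zpowers (a₀ p m ^ p ^ (m - 1) * aLast p m ^ p ^ (m - 2))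

/-- The family `𝒩` of normal subgroups `N` of `U` with `D ≤ N ≤ Φ(U)`, `N ∩ ⟨a₀⟩ = 1` and
`U' ≰ N`. -/
def family (p m : ℕ) [Fact p.Prime] : Set (Subgroup (U p m)) :=
  {N | N.Normal ∧ D p m ≤ N ∧ N ≤ frattini (U p m) ∧
    N ⊓ Subgroup.zpowers (a₀ p m) = ⊥ ∧ ¬ commutator (U p m) ≤ N}

end TypeA

/-! Let `delta` = φ − 1 and `tr` = 1 + φ + ⋯ + φ^(p−1) on `W`, written additively, with m ≥ 2. Each
element of `W` is c·a₀ + `delta` v; p^(m−1) kills the image of `delta`, and so does `tr`, because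
φ^p = 1. Expanding `tr` in powers of `delta` shows that p^(m−2)·`tr` a₀ is exactly the generator of
`D`. It is also the p^(m−1)-th power of a₀b₀⁻¹.

Let A = W⟨b₀^p⟩, which is abelian of index p. Outside A, all p^(m−1)-th powers lie in `D`
(`pow_mem_D_of_not_dvd`). Inside A, they vanish when p ∣ c. So in U/N an element whose p^(m−1)-th
power is nontrivial comes from A with p ∤ c; a maximal subgroup containing it contains a₀, hence not
b₀, and is A/N. Thus proper non-abelian subgroups have exponent dividing p^(m−1), while a₀ keeps
order p^m. A second abelian maximal subgroup would meet A/N in the centre, which forces a₀^(p^(m−1))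
∈ N unless p = m = 2.

Conversely, let M be the only abelian maximal subgroup of P. The other maximal subgroups are
non-abelian, so elements outside M have order dividing p^(m−1), and some x ∈ M has order p^m. For b
∉ M, the universal property of `U` (`exists_monoidHom_U`) gives a map a₀ ↦ x, b₀ ↦ b; it is onto and
its kernel is in the family (`exists_surjective`, `exists_mem_family`). For p = m = 2 one has
`delta`² = 0, which makes a second maximal subgroup abelian. -/

/-! ### Maximal subgroups of finite p-groups -/

/-- An element of a finite `p`-group lies in a subgroup as soon as some power of it of exponent
prime to `p` does. -/
theorem IsPGroup.mem_of_pow_mem {p : ℕ} [hp : Fact p.Prime] {G : Type*} [Group G]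
    (hG : IsPGroup p G) {K : Subgroup G} {g : G} {j : ℕ} (hj : ¬ p ∣ j) (h : g ^ j ∈ K) :
    g ∈ K := by
  obtain ⟨n, hn⟩ := hG.exists_pow_pow_eq_one g
  have hco : (orderOf g).Coprime j :=
    Nat.Coprime.coprime_dvd_left (orderOf_dvd_of_pow_eq_one hn)
      (((Nat.Prime.coprime_iff_not_dvd hp.out).2 hj).pow_left n)
  obtain ⟨i, hi⟩ := exists_pow_eq_self_of_coprime hco.symm
  rw [← hi]
  exact K.pow_mem h i

theorem IsPGroup.normal_of_isCoatom {p : ℕ} [Fact p.Prime] {G : Type*} [Group G] [Finite G]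
    (hG : IsPGroup p G) {K : Subgroup G} (hK : IsCoatom K) : K.Normal :=
  have := hG.isNilpotent
  Subgroup.NormalizerCondition.normal_of_coatom K Group.normalizerCondition_of_isNilpotent hK

theorem IsPGroup.exists_eq_mul_zpow {p : ℕ} [Fact p.Prime] {G : Type*} [Group G] [Finite G]
    (hG : IsPGroup p G) {K : Subgroup G} (hK : IsCoatom K) {b : G} (hb : b ∉ K) (g : G) :
    ∃ y ∈ K, ∃ i : ℤ, g = y * b ^ i := by
  have := hG.normal_of_isCoatom hK
  have htop : K ⊔ Subgroup.zpowers b = ⊤ := hK.2 _ (lt_of_le_of_ne le_sup_left fun h => hb (by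
    rw [h]; exact Subgroup.mem_sup_right (Subgroup.mem_zpowers b)))
  have hg : g ∈ K ⊔ Subgroup.zpowers b := htop ▸ Subgroup.mem_top g
  obtain ⟨y, hy, z, ⟨i, rfl⟩, rfl⟩ := Subgroup.mem_sup_of_normal_left.1 hg
  exact ⟨y, hy, i, rfl⟩

theorem IsPGroup.pow_mem_of_isCoatom {p : ℕ} [hp : Fact p.Prime] {G : Type*} [Group G] [Finite G]
    (hG : IsPGroup p G) {K : Subgroup G} (hK : IsCoatom K) (g : G) : g ^ p ∈ K := by
  by_contra hgp
  have hg : g ∉ K := fun h => hgp (K.pow_mem h p)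
  obtain ⟨y, hy, i, hi⟩ := hG.exists_eq_mul_zpow hK hgp g
  obtain ⟨n, hn⟩ := hG.exists_pow_pow_eq_one g
  -- If g^p ∉ K, then g ∈ K·g^(pi) for some i, so g^(1−pi) ∈ K; since 1 − pi is prime to the order
  -- of g, this gives g ∈ K.
  have hco : IsCoprime (1 - p * i : ℤ) ((p ^ n : ℕ) : ℤ) := by
    push_cast
    exact IsCoprime.pow_right ⟨1, i, by ring⟩
  obtain ⟨s, t, hst⟩ := hco
  have hmem : g ^ (1 - p * i : ℤ) ∈ K := by
    have : g ^ (1 - p * i : ℤ) = y := by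
      rw [zpow_sub, zpow_one, zpow_mul, zpow_natCast, mul_inv_eq_iff_eq_mul]
      exact hi
    rwa [this]
  apply hg
  have : g = (g ^ (1 - p * i : ℤ)) ^ s := by
    conv_lhs => rw [← zpow_one g, ← hst]
    rw [zpow_add, mul_comm s, zpow_mul, mul_comm t, zpow_mul g _ t, zpow_natCast, hn, one_zpow,
      mul_one]
  rw [this]
  exact K.zpow_mem hmem s

theorem IsPGroup.commutator_le_of_isCoatom {p : ℕ} [Fact p.Prime] {G : Type*} [Group G] [Finite G]
    (hG : IsPGroup p G) {K : Subgroup G} (hK : IsCoatom K) : commutator G ≤ K := by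
  have := hG.normal_of_isCoatom hK
  obtain ⟨b, hb⟩ : ∃ b, b ∉ K := by
    by_contra! h
    exact hK.1 ((Subgroup.eq_top_iff' K).2 h)
  rw [← Subgroup.Normal.quotient_commutative_iff_commutator_le]
  have : IsCyclic (G ⧸ K) := ⟨(b : G ⧸ K), fun q => by
    induction q using QuotientGroup.induction_on with
    | H g =>
      obtain ⟨y, hy, i, rfl⟩ := hG.exists_eq_mul_zpow hK hb g
      exact ⟨i, by
        rw [QuotientGroup.mk_mul, (QuotientGroup.eq_one_iff y).2 hy, one_mul]; rfl⟩⟩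
  infer_instance

theorem IsPGroup.conj_mul_inv_mem_of_isCoatom {p : ℕ} [Fact p.Prime] {G : Type*} [Group G]
    [Finite G] (hG : IsPGroup p G) {K : Subgroup G} (hK : IsCoatom K) (g h : G) :
    g⁻¹ * h * g * h⁻¹ ∈ K := by
  have := hG.commutator_le_of_isCoatom hK
    (Subgroup.commutator_mem_commutator (Subgroup.mem_top g⁻¹) (Subgroup.mem_top h))
  rwa [commutatorElement_def, inv_inv] at this

/-! ### Exponent-criticality in terms of p^(m−1)-th powers -/

/-- In an exponent-critical `p`-group of exponent `p ^ m`, the exponent of a proper non-abelian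
subgroup divides `p ^ (m - 1)`. -/
theorem IsExponentCritical.pow_eq_one {p m : ℕ} [hp : Fact p.Prime] {G : Type*} [Group G]
    (hG : IsExponentCritical G) (hexp : Monoid.exponent G = p ^ m) {H : Subgroup G} (hH : H ≠ ⊤)
    (hnc : ¬ IsMulCommutative H) {h : G} (hh : h ∈ H) : h ^ p ^ (m - 1) = 1 := by
  obtain ⟨hfin, hne⟩ := hG
  have hmem : H ∈ (Set.toFinite {H : Subgroup G | H ≠ ⊤ ∧ ¬ IsMulCommutative H}).toFinset := by
    simp [hH, hnc]
  set L := (Set.toFinite {H : Subgroup G | H ≠ ⊤ ∧ ¬ IsMulCommutative H}).toFinset.lcm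
    (fun H => Monoid.exponent H) with hL
  have hLdvd : L ∣ p ^ m := by
    refine Finset.lcm_dvd fun K _ => ?_
    rw [← hexp]
    exact Monoid.exponent_dvd_of_monoidHom K.subtype K.subtype_injective
  obtain ⟨i, hi, hLi⟩ := (Nat.dvd_prime_pow hp.out).1 hLdvd
  have him : i ≠ m := fun h => hne (by rw [hexp, ← h, hLi])
  have hd : Monoid.exponent H ∣ p ^ (m - 1) :=
    (Finset.dvd_lcm hmem).trans (hLi.dvd.trans (pow_dvd_pow _ (by omega)))
  have := (Monoid.exponent_dvd_iff_forall_pow_eq_one).1 hd ⟨h, hh⟩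
  simpa using congrArg Subtype.val this

theorem isExponentCritical_of_forall_pow_eq_one {p m : ℕ} [hp : Fact p.Prime] {G : Type*} [Group G]
    [hfin : Finite G] (hm : m ≠ 0) (hexp : Monoid.exponent G = p ^ m)
    (h : ∀ H : Subgroup G, H ≠ ⊤ → ¬ IsMulCommutative H → ∀ g ∈ H, g ^ p ^ (m - 1) = 1) :
    IsExponentCritical G := by
  refine ⟨hfin, fun heq => ?_⟩
  have hdvd : p ^ m ∣ p ^ (m - 1) := by
    rw [← hexp, heq]
    refine Finset.lcm_dvd fun K hK => ?_
    have hK' : K ≠ ⊤ ∧ ¬ IsMulCommutative K := by simpa using hK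
    refine (Monoid.exponent_dvd_iff_forall_pow_eq_one).2 fun g => Subtype.ext ?_
    simpa using h K hK'.1 hK'.2 g g.2
  have := (Nat.pow_dvd_pow_iff_le_right hp.out.one_lt).1 hdvd
  omega

theorem Subgroup.isMulCommutative_iff_forall_mem {G : Type*} [Group G] {H : Subgroup G} :
    IsMulCommutative H ↔ ∀ x ∈ H, ∀ y ∈ H, x * y = y * x := by
  simp [isMulCommutative_iff, Subtype.ext_iff]

/-! ### The operators φ − 1 and 1 + φ + ⋯ + φ^(p−1) on W -/

namespace TypeA

variable {p m : ℕ}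

theorem ord_dvd_pow (i : Fin p) : ord p m i ∣ p ^ m := by
  unfold ord
  split_ifs
  · exact dvd_rfl
  · exact pow_dvd_pow _ (Nat.sub_le _ _)

/-- The endomorphism `φ - 1` of `W`. -/
def delta (p m : ℕ) : Module.End ℤ (AddW p m) := addPhi p m - 1

theorem addPhi_eq : addPhi p m = delta p m + 1 := by simp [delta]

theorem addPhi_apply (w : AddW p m) : addPhi p m w = delta p m w + w := by
  simp [delta]

theorem delta_gen (j : ℕ) (hj : j + 1 < p) :
    delta p m (gen p m ⟨j, by omega⟩) = gen p m ⟨j + 1, hj⟩ := by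
  rw [delta, LinearMap.sub_apply, addPhi_gen, img, dif_pos hj]
  simp

theorem gen_mem_range_delta (i : Fin p) (hi : i.val ≠ 0) :
    gen p m i ∈ LinearMap.range (delta p m) := by
  obtain ⟨i, hi'⟩ := i
  obtain ⟨j, rfl⟩ := Nat.exists_eq_succ_of_ne_zero hi
  exact ⟨gen p m ⟨j, by omega⟩, delta_gen j hi'⟩

theorem pow_nsmul_eq_zero (w : AddW p m) : p ^ m • w = 0 := by
  ext i
  obtain ⟨d, hd⟩ := ord_dvd_pow (m := m) i
  rw [Pi.smul_apply, hd, mul_comm, mul_nsmul']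
  simp

/-- This is the identity ((1 + X)^p − 1)/X = Σ C(p, i+1) X^i evaluated at `delta`. -/
theorem sum_addPhi_pow :
    ∑ i ∈ Finset.range p, addPhi p m ^ i =
      ∑ i ∈ Finset.range p, (p.choose (i + 1)) • delta p m ^ i := by
  have h := congrArg (Polynomial.aeval (delta p m))
    (Polynomial.geom_sum_X_comp_X_add_one_eq_sum (R := ℤ) p)
  rw [Polynomial.aeval_comp] at h
  simpa [← addPhi_eq, nsmul_eq_mul] using h

/-- The trace endomorphism `1 + φ + ⋯ + φ ^ (p - 1)` of `W`. -/
def tr (p m : ℕ) : Module.End ℤ (AddW p m) := ∑ i ∈ Finset.range p, addPhi p m ^ i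

variable [hp : Fact p.Prime]

instance neZero_ord (i : Fin p) : NeZero (ord p m i) :=
  ⟨fun h => by
    have := ord_dvd_pow (m := m) i
    rw [h, zero_dvd_iff] at this
    exact pow_ne_zero m hp.out.ne_zero this⟩

instance neZero_pow_prime (n : ℕ) : NeZero (p ^ n) := ⟨pow_ne_zero n hp.out.ne_zero⟩

instance finite_U : Finite (U p m) :=
  Finite.of_equiv _ SemidirectProduct.equivProd.symm

theorem isPGroup_U : IsPGroup p (U p m) := by
  refine IsPGroup.of_card_dvd_pow (n := m * p + (m - 1)) ?_
  have h1 : Nat.card (W p m) = ∏ i : Fin p, ord p m i := by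
    change Nat.card (∀ i : Fin p, ZMod (ord p m i)) = _
    rw [Nat.card_pi]
    exact Finset.prod_congr rfl fun i _ => Nat.card_zmod _
  have h2 : Nat.card (B p m) = p ^ (m - 1) := Nat.card_zmod _
  rw [SemidirectProduct.card, h1, h2, pow_add]
  refine mul_dvd_mul_right ?_ _
  have : p ^ (m * p) = ∏ _i : Fin p, p ^ m := by simp [pow_mul]
  rw [this]
  exact Finset.prod_dvd_prod_of_dvd _ _ fun i _ => ord_dvd_pow i

/-- The generator of `W` of order `p ^ m`, written additively. -/
def gen₀ (p m : ℕ) [hp : Fact p.Prime] : AddW p m := gen p m ⟨0, hp.out.pos⟩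

theorem delta_pow_gen₀ (j : ℕ) (hj : j < p) :
    (delta p m ^ j) (gen₀ p m) = gen p m ⟨j, hj⟩ := by
  induction j with
  | zero => rfl
  | succ j ih => rw [pow_succ', Module.End.mul_apply, ih (by omega), delta_gen j hj]

/-- Every generator other than a₀ is a value of `delta`. Later arguments depend on w only through
whether p divides c. -/
theorem exists_eq_add_delta (w : AddW p m) :
    ∃ (c : ℕ) (v : AddW p m), w = c • gen₀ p m + delta p m v := by
  have hs : ∀ i, Pi.single i (w i) = (w i).val • gen p m i := fun i => by
    rw [gen, ← Pi.single_smul, nsmul_one, ZMod.natCast_zmod_val]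
  have hw : w = ∑ i, (w i).val • gen p m i := by
    conv_lhs => rw [← Finset.univ_sum_single w]
    exact Finset.sum_congr rfl fun i _ => hs i
  rw [← Finset.add_sum_erase _ _ (Finset.mem_univ (⟨0, hp.out.pos⟩ : Fin p))] at hw
  have hr : ∑ i ∈ Finset.univ.erase (⟨0, hp.out.pos⟩ : Fin p), (w i).val • gen p m i ∈
      LinearMap.range (delta p m) :=
    Submodule.sum_mem _ fun i hi => nsmul_mem (gen_mem_range_delta i fun h =>
      (Finset.mem_erase.1 hi).1 (Fin.ext h)) _
  obtain ⟨v, hv⟩ := hr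
  exact ⟨_, v, by rw [hv]; exact hw⟩

theorem nsmul_delta_gen₀ : p ^ (m - 1) • delta p m (gen₀ p m) = 0 := by
  rw [gen₀, delta_gen 0 hp.out.one_lt]
  exact ord_nsmul_gen p m ⟨0 + 1, hp.out.one_lt⟩

theorem nsmul_delta (w : AddW p m) : p ^ (m - 1) • delta p m w = 0 := by
  have h : ∀ i, p ^ (m - 1) • delta p m (gen p m i) = 0 := by
    intro i
    rw [← delta_pow_gen₀ i.val i.isLt, ← Module.End.mul_apply, ← pow_succ', pow_succ,
      Module.End.mul_apply, ← map_nsmul, nsmul_delta_gen₀, map_zero]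
  have h' := end_ext p m (p ^ (m - 1) • delta p m) 0 fun i => h i
  exact LinearMap.congr_fun h' w

theorem tr_delta (w : AddW p m) : tr p m (delta p m w) = 0 := by
  rw [← Module.End.mul_apply, tr, delta, geom_sum_mul, addPhi_pow_prime, sub_self,
    LinearMap.zero_apply]

theorem addPhi_tr (w : AddW p m) : addPhi p m (tr p m w) = tr p m w := by
  rw [addPhi_apply, ← Module.End.mul_apply, tr, delta, mul_geom_sum, addPhi_pow_prime, sub_self,
    LinearMap.zero_apply, zero_add]

/-- In the expansion of `tr` the extreme terms give the right-hand side. Each middle term has a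
coefficient divisible by p and a factor `delta`, so p^(m−2) kills it. -/
theorem nsmul_tr_gen₀ (hm : 2 ≤ m) :
    p ^ (m - 2) • tr p m (gen₀ p m) = p ^ (m - 1) • gen₀ p m +
      p ^ (m - 2) • gen p m ⟨p - 1, Nat.sub_lt hp.out.pos one_pos⟩ := by
  obtain ⟨n, rfl⟩ := Nat.exists_eq_add_of_le hm
  obtain ⟨q, hq⟩ := Nat.exists_eq_add_of_le hp.out.two_le
  have hp1 : p ^ (2 + n - 2) * p = p ^ (2 + n - 1) := by
    rw [← pow_succ]; congr 1; omega
  rw [tr, sum_addPhi_pow, LinearMap.sum_apply,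
    show Finset.range p = Finset.range (q + 1 + 1) by congr 1; omega,
    Finset.sum_range_succ, Finset.sum_range_succ', nsmul_add, nsmul_add, Finset.smul_sum,
    Finset.sum_eq_zero, zero_add]
  · congr 1
    · rw [LinearMap.smul_apply, pow_zero, Module.End.one_apply, Nat.choose_one_right, smul_smul,
        hp1]
    · rw [LinearMap.smul_apply, show q + 1 + 1 = p by omega, Nat.choose_self, one_smul,
        delta_pow_gen₀ (q + 1) (by omega)]
      congr 3
      omega
  · intro i hi
    rw [Finset.mem_range] at hi
    obtain ⟨d, hd⟩ : p ∣ p.choose (i + 1 + 1) := hp.out.dvd_choose_self (by omega) (by omega)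
    rw [LinearMap.smul_apply, hd, smul_smul, ← mul_assoc, hp1, mul_comm, mul_smul, pow_succ',
      Module.End.mul_apply, nsmul_delta, smul_zero]

/-! ### Powers and commutation in U -/

/-- The embedding of `W`, written additively, into `U`. -/
def inW (w : AddW p m) : U p m := SemidirectProduct.inl (Multiplicative.ofAdd w)

theorem inW_add (v w : AddW p m) : inW (v + w) = inW v * inW w := by
  rw [inW, ofAdd_add, map_mul]; rfl

theorem inW_zero : inW (0 : AddW p m) = 1 := by
  rw [inW, ofAdd_zero, map_one]

theorem inW_nsmul (n : ℕ) (w : AddW p m) : inW (n • w) = inW w ^ n := by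
  exact map_pow (SemidirectProduct.inl (φ := act p m)) (Multiplicative.ofAdd w) n

theorem inW_neg (w : AddW p m) : inW (-w) = (inW w)⁻¹ := by
  exact map_inv (SemidirectProduct.inl (φ := act p m)) (Multiplicative.ofAdd w)

theorem inW_injective : Function.Injective (inW : AddW p m → U p m) := fun _ _ h =>
  Multiplicative.ofAdd.injective (SemidirectProduct.inl_injective h)

theorem inW_gen₀ : inW (gen₀ p m) = a₀ p m := rfl

theorem inW_comm (v w : AddW p m) : Commute (inW v) (inW w) := by
  rw [Commute, SemiconjBy, ← inW_add, ← inW_add, add_comm]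

theorem act_ofAdd_one : act p m (Multiplicative.ofAdd 1) = (phi p m)⁻¹ := by
  have := ZMod.lift_coe (p ^ (m - 1))
    ⟨zmultiplesHom (Additive (MulAut (W p m))) (Additive.ofMul (phi p m)⁻¹), by
      rw [zmultiplesHom_apply, ← ofMul_zpow, zpow_natCast, inv_pow, phi_pow, inv_one,
        ofMul_one]⟩ 1
  have h2 := congrArg Additive.toMul this
  simpa [act] using h2

theorem inW_addPhi (w : AddW p m) :
    inW (addPhi p m w) = (b₀ p m)⁻¹ * inW w * b₀ p m := by
  have h := SemidirectProduct.inl_aut_inv (φ := act p m) (Multiplicative.ofAdd 1)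
    (Multiplicative.ofAdd w)
  rw [act_ofAdd_one, inv_inv] at h
  rw [inW, b₀, ← map_inv]
  exact h

theorem inW_delta (w : AddW p m) :
    inW (delta p m w) = (b₀ p m)⁻¹ * inW w * b₀ p m * (inW w)⁻¹ := by
  rw [← inW_addPhi, ← inW_neg, ← inW_add, addPhi_apply, add_neg_cancel_right]

theorem b₀_inv_mul_inW (w : AddW p m) :
    (b₀ p m)⁻¹ * inW w = inW (addPhi p m w) * (b₀ p m)⁻¹ := by
  rw [inW_addPhi]; group

theorem b₀_pow_inv_mul_inW (w : AddW p m) (n : ℕ) :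
    (b₀ p m)⁻¹ ^ n * inW w = inW ((addPhi p m ^ n) w) * (b₀ p m)⁻¹ ^ n := by
  induction n generalizing w with
  | zero => simp
  | succ n ih =>
    rw [pow_succ, mul_assoc, b₀_inv_mul_inW, ← mul_assoc, ih, mul_assoc, pow_succ,
      Module.End.mul_apply]

theorem commute_b₀_inW {w : AddW p m} (hw : delta p m w = 0) : Commute (b₀ p m) (inW w) := by
  have h := b₀_inv_mul_inW w
  rw [addPhi_apply, hw, zero_add] at h
  exact (Commute.inv_left_iff.1 h)

theorem commute_b₀_pow_inW (w : AddW p m) : Commute (b₀ p m ^ p) (inW w) := by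
  have h := b₀_pow_inv_mul_inW w p
  rw [addPhi_pow_prime, Module.End.one_apply, inv_pow] at h
  exact (Commute.inv_left_iff.1 h)

theorem b₀_pow (n : ℕ) : b₀ p m ^ n = SemidirectProduct.inr (Multiplicative.ofAdd (n : ZMod _)) := by
  rw [b₀, ← map_pow, ← ofAdd_nsmul, nsmul_one]

theorem b₀_pow_eq_one : b₀ p m ^ p ^ (m - 1) = 1 := by
  rw [b₀_pow, ZMod.natCast_self, ofAdd_zero, map_one]

theorem inW_mul_b₀_inv_pow (w : AddW p m) (n : ℕ) :
    (inW w * (b₀ p m)⁻¹) ^ n =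
      inW ((∑ i ∈ Finset.range n, addPhi p m ^ i) w) * (b₀ p m)⁻¹ ^ n := by
  induction n with
  | zero => simp [inW_zero]
  | succ n ih =>
    rw [pow_succ', ih, geom_sum_succ, mul_assoc, ← mul_assoc (b₀ p m)⁻¹, b₀_inv_mul_inW,
      mul_assoc, ← pow_succ', ← mul_assoc, ← inW_add, LinearMap.add_apply, Module.End.mul_apply,
      Module.End.one_apply, add_comm]

/-- The p-th power is `tr` w · b₀^(−p). Its factors commute because φ fixes `tr` w, and b₀^(−p) dies
under the remaining power p^(m−2). -/
theorem inW_mul_b₀_inv_pow_pow (hm : 2 ≤ m) (w : AddW p m) :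
    (inW w * (b₀ p m)⁻¹) ^ p ^ (m - 1) = inW (p ^ (m - 2) • tr p m w) := by
  have h1 : p ^ (m - 1) = p * p ^ (m - 2) := by rw [← pow_succ']; congr 1; omega
  have hc : Commute (inW (tr p m w)) ((b₀ p m)⁻¹ ^ p) := by
    refine ((commute_b₀_inW ?_).symm.inv_right).pow_right p
    have := addPhi_tr w
    rwa [addPhi_apply, add_eq_right] at this
  have hb : ((b₀ p m)⁻¹ ^ p) ^ p ^ (m - 2) = 1 := by
    rw [← pow_mul, inv_pow, inv_eq_one]
    exact (congrArg (b₀ p m ^ ·) h1).symm.trans b₀_pow_eq_one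
  refine (congrArg (_ ^ ·) h1).trans ?_
  rw [pow_mul, inW_mul_b₀_inv_pow, ← tr, hc.mul_pow, hb, mul_one, inW_nsmul]

theorem inW_nsmul_tr_gen₀ (hm : 2 ≤ m) : inW (p ^ (m - 2) • tr p m (gen₀ p m)) =
    a₀ p m ^ p ^ (m - 1) * aLast p m ^ p ^ (m - 2) := by
  rw [nsmul_tr_gen₀ hm, inW_add, inW_nsmul, inW_nsmul]
  rfl

theorem inW_mul_b₀_inv_pow_mem_D (hm : 2 ≤ m) (w : AddW p m) :
    (inW w * (b₀ p m)⁻¹) ^ p ^ (m - 1) ∈ D p m := by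
  obtain ⟨c, v, rfl⟩ := exists_eq_add_delta w
  rw [inW_mul_b₀_inv_pow_pow hm, map_add, tr_delta, add_zero, map_nsmul, smul_comm,
    inW_nsmul c, inW_nsmul_tr_gen₀ hm]
  exact Subgroup.pow_mem _ (Subgroup.mem_zpowers _) c

theorem exists_eq_inW_mul_b₀_pow (u : U p m) : ∃ (w : AddW p m) (j : ℕ), u = inW w * b₀ p m ^ j := by
  refine ⟨u.left.toAdd, u.right.toAdd.val, ?_⟩
  rw [b₀_pow, ZMod.natCast_zmod_val]
  exact (SemidirectProduct.inl_left_mul_inr_right u).symm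

theorem right_inW_mul_b₀_pow (w : AddW p m) (j : ℕ) :
    (inW w * b₀ p m ^ j).right = Multiplicative.ofAdd (j : ZMod _) := by
  rw [b₀_pow]; simp [inW]

theorem pow_mem_D_of_not_dvd (hm : 2 ≤ m) (w : AddW p m) {j : ℕ} (hj : ¬ p ∣ j) :
    (inW w * b₀ p m ^ j) ^ p ^ (m - 1) ∈ D p m := by
  set u := inW w * b₀ p m ^ j with hu
  -- With v = −1/j, the power of u by a representative i of v has the form w'·b₀⁻¹, already treated.
  -- As p ∤ i, membership in `D` descends from the i-th power.
  let v : (ZMod (p ^ (m - 1)))ˣ :=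
    -(ZMod.unitOfCoprime j (((Nat.Prime.coprime_iff_not_dvd hp.out).2 hj).symm.pow_right _))⁻¹
  have hv : (j : ZMod (p ^ (m - 1))) * (v : ZMod (p ^ (m - 1))) = -1 := by
    have := (ZMod.unitOfCoprime j
      (((Nat.Prime.coprime_iff_not_dvd hp.out).2 hj).symm.pow_right (m - 1))).mul_inv
    rw [ZMod.coe_unitOfCoprime] at this
    simp only [v, Units.val_neg, mul_neg, this]
  have hcop := ZMod.val_coe_unit_coprime v
  set i := (v : ZMod (p ^ (m - 1))).val with hi
  have hpi : ¬ p ∣ i := fun h => hp.out.one_lt.ne' (Nat.dvd_one.1 (hcop ▸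
    Nat.dvd_gcd h (dvd_pow_self p (by omega))))
  have hr : (u ^ i).right = Multiplicative.ofAdd (-1) := by
    have : (u ^ i).right = u.right ^ i := map_pow SemidirectProduct.rightHom u i
    rw [this, hu, right_inW_mul_b₀_pow, ← ofAdd_nsmul, nsmul_eq_mul, hi, ZMod.natCast_zmod_val,
      mul_comm, hv]
  have hui : u ^ i = inW (u ^ i).left.toAdd * (b₀ p m)⁻¹ := by
    rw [b₀, ← map_inv, ← ofAdd_neg, ← hr]
    exact (SemidirectProduct.inl_left_mul_inr_right _).symm
  refine isPGroup_U.mem_of_pow_mem hpi ?_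
  rw [← pow_mul, mul_comm, pow_mul, hui]
  exact inW_mul_b₀_inv_pow_mem_D hm _

theorem commute_of_dvd (v w : AddW p m) {i j : ℕ} (hi : p ∣ i) (hj : p ∣ j) :
    Commute (inW v * b₀ p m ^ i) (inW w * b₀ p m ^ j) := by
  have h : ∀ (w : AddW p m) {i : ℕ}, p ∣ i → Commute (b₀ p m ^ i) (inW w) := by
    rintro w _ ⟨d, rfl⟩
    rw [pow_mul]
    exact (commute_b₀_pow_inW w).pow_left d
  exact ((inW_comm v w).mul_right (h v hj).symm).mul_left
    ((h w hi).mul_right (Commute.pow_pow_self _ _ _))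

theorem pow_of_dvd (w : AddW p m) {j : ℕ} (hj : p ∣ j) (n : ℕ) :
    (inW w * b₀ p m ^ j) ^ n = inW (n • w) * b₀ p m ^ (j * n) := by
  have h : Commute (inW w) (b₀ p m ^ j) := by
    simpa [inW_zero] using commute_of_dvd w (0 : AddW p m) (dvd_zero p) hj
  rw [h.mul_pow, inW_nsmul, pow_mul]

theorem pow_eq_one_of_dvd (w : AddW p m) {j : ℕ} (hj : p ∣ j) :
    (inW w * b₀ p m ^ j) ^ p ^ m = 1 := by
  obtain ⟨d, hd⟩ : p ^ (m - 1) ∣ p ^ m := pow_dvd_pow _ (Nat.sub_le _ _)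
  have hb : b₀ p m ^ (j * p ^ m) = 1 := by
    rw [hd, mul_left_comm, pow_mul, b₀_pow_eq_one, one_pow]
  rw [pow_of_dvd w hj, pow_nsmul_eq_zero, inW_zero, one_mul, hb]

theorem pow_eq_one_of_dvd_of_dvd {c j : ℕ} (hm : m ≠ 0) (hc : p ∣ c) (hj : p ∣ j)
    (v : AddW p m) :
    (inW (c • gen₀ p m + delta p m v) * b₀ p m ^ j) ^ p ^ (m - 1) = 1 := by
  obtain ⟨d, rfl⟩ := hc
  rw [pow_of_dvd _ hj, nsmul_add, nsmul_delta, add_zero, smul_smul, ← mul_assoc, ← pow_succ,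
    Nat.sub_add_cancel (by omega), mul_comm, mul_smul, pow_nsmul_eq_zero, smul_zero, inW_zero,
    one_mul, mul_comm, pow_mul, b₀_pow_eq_one, one_pow]

theorem a₀_pow_ne_one (hm : m ≠ 0) : a₀ p m ^ p ^ (m - 1) ≠ 1 := by
  rw [← inW_gen₀, ← inW_nsmul, ← inW_zero]
  intro h
  have h2 := congrFun (inW_injective h) (⟨0, hp.out.pos⟩ : Fin p)
  rw [gen₀, gen, ← Pi.single_smul, Pi.single_eq_same, Pi.zero_apply, nsmul_one,
    ZMod.natCast_eq_zero_iff, ord, if_pos rfl,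
    Nat.pow_dvd_pow_iff_le_right hp.out.one_lt] at h2
  omega

/-! ### Maximal subgroups of U -/

theorem eq_top_of_mem {K : Subgroup (U p m)} (ha : a₀ p m ∈ K) (hb : b₀ p m ∈ K)
    (hd : ∀ v, inW (delta p m v) ∈ K) : K = ⊤ := by
  rw [Subgroup.eq_top_iff']
  intro u
  obtain ⟨w, j, rfl⟩ := exists_eq_inW_mul_b₀_pow u
  obtain ⟨c, v, rfl⟩ := exists_eq_add_delta w
  rw [inW_add, inW_nsmul]
  exact K.mul_mem (K.mul_mem (K.pow_mem ha c) (hd v)) (K.pow_mem hb j)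

theorem inW_delta_mem_of_isCoatom {K : Subgroup (U p m)} (hK : IsCoatom K) (v : AddW p m) :
    inW (delta p m v) ∈ K := by
  rw [inW_delta]
  exact isPGroup_U.conj_mul_inv_mem_of_isCoatom hK _ _

/-- The homomorphism from `U` to the cyclic group of order `p` that kills `W` and maps `b₀` to the
generator. -/
def bChar (hm : 2 ≤ m) : U p m →* Multiplicative (ZMod p) :=
  (ZMod.castHom (dvd_pow_self p (by omega : m - 1 ≠ 0)) (ZMod p)).toAddMonoidHom.toMultiplicative.comp
    SemidirectProduct.rightHom

theorem bChar_apply (hm : 2 ≤ m) (w : AddW p m) (j : ℕ) :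
    bChar hm (inW w * b₀ p m ^ j) = Multiplicative.ofAdd (j : ZMod p) := by
  change Multiplicative.ofAdd (ZMod.castHom (dvd_pow_self p (by omega : m - 1 ≠ 0)) (ZMod p)
    (inW w * b₀ p m ^ j).right.toAdd) = _
  rw [right_inW_mul_b₀_pow, toAdd_ofAdd, map_natCast]

theorem mem_ker_bChar (hm : 2 ≤ m) (w : AddW p m) (j : ℕ) :
    inW w * b₀ p m ^ j ∈ (bChar (p := p) hm).ker ↔ p ∣ j := by
  rw [MonoidHom.mem_ker, bChar_apply, ofAdd_eq_one, ZMod.natCast_eq_zero_iff]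

theorem bChar_surjective (hm : 2 ≤ m) : Function.Surjective (bChar (p := p) hm) := fun x =>
  ⟨inW 0 * b₀ p m ^ x.toAdd.val, by rw [bChar_apply, ZMod.natCast_zmod_val]; rfl⟩

end TypeA

/-! ### Quotients by members of the family -/

namespace TypeA

variable {p m : ℕ} [hp : Fact p.Prime]

section Quotient

variable {N : Subgroup (U p m)}

theorem a₀_pow_notMem (hm : m ≠ 0) (hN : N ⊓ Subgroup.zpowers (a₀ p m) = ⊥) :
    a₀ p m ^ p ^ (m - 1) ∉ N := fun h => by
  have h' : a₀ p m ^ p ^ (m - 1) ∈ N ⊓ Subgroup.zpowers (a₀ p m) :=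
    ⟨h, Subgroup.pow_mem _ (Subgroup.mem_zpowers _) _⟩
  rw [hN, Subgroup.mem_bot] at h'
  exact a₀_pow_ne_one hm h'

variable [N.Normal]

theorem quotient_pow_eq_one (hm : 2 ≤ m) (hD : D p m ≤ N) (g : U p m ⧸ N) : g ^ p ^ m = 1 := by
  induction g using QuotientGroup.induction_on with
  | H u =>
    obtain ⟨w, j, rfl⟩ := exists_eq_inW_mul_b₀_pow u
    rw [← QuotientGroup.mk_pow, QuotientGroup.eq_one_iff]
    by_cases hj : p ∣ j
    · rw [pow_eq_one_of_dvd w hj]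
      exact N.one_mem
    · obtain ⟨d, hd⟩ : p ^ (m - 1) ∣ p ^ m := pow_dvd_pow _ (Nat.sub_le _ _)
      rw [hd, pow_mul]
      exact N.pow_mem (hD (pow_mem_D_of_not_dvd hm w hj)) d

theorem exponent_quotient (hm : 2 ≤ m) (hD : D p m ≤ N)
    (hN : N ⊓ Subgroup.zpowers (a₀ p m) = ⊥) : Monoid.exponent (U p m ⧸ N) = p ^ m := by
  have hdvd : Monoid.exponent (U p m ⧸ N) ∣ p ^ (m - 1 + 1) := by
    rw [Nat.sub_add_cancel (by omega : 1 ≤ m)]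
    exact Monoid.exponent_dvd_of_forall_pow_eq_one (quotient_pow_eq_one hm hD)
  refine (Nat.eq_prime_pow_of_dvd_least_prime_pow hp.out (fun h => ?_) hdvd).trans
    (congrArg _ (by omega))
  have h1 := Monoid.exponent_dvd_iff_forall_pow_eq_one.1 h (a₀ p m : U p m ⧸ N)
  rw [← QuotientGroup.mk_pow, QuotientGroup.eq_one_iff] at h1
  exact a₀_pow_notMem (by omega) hN h1

theorem pow_eq_one_of_ne_top (hm : 2 ≤ m) (hD : D p m ≤ N) {H : Subgroup (U p m ⧸ N)}
    (hH : H ≠ ⊤) (hnc : ¬ IsMulCommutative H) {g : U p m ⧸ N} (hg : g ∈ H) :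
    g ^ p ^ (m - 1) = 1 := by
  obtain ⟨u, rfl⟩ := QuotientGroup.mk_surjective g
  obtain ⟨w, j, rfl⟩ := exists_eq_inW_mul_b₀_pow u
  obtain ⟨c, v, rfl⟩ := exists_eq_add_delta w
  by_cases hj : p ∣ j
  swap
  · rw [← QuotientGroup.mk_pow, QuotientGroup.eq_one_iff]
    exact hD (pow_mem_D_of_not_dvd hm _ hj)
  by_cases hc : p ∣ c
  · rw [← QuotientGroup.mk_pow, pow_eq_one_of_dvd_of_dvd (by omega) hc hj, QuotientGroup.mk_one]
  exfalso
  obtain ⟨K', hK', hHK'⟩ := (eq_top_or_exists_le_coatom H).resolve_left hH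
  have hK := Subgroup.isCoatom_comap_of_surjective (QuotientGroup.mk'_surjective N) hK'
  set K := K'.comap (QuotientGroup.mk' N) with hKdef
  have hd : ∀ v, inW (delta p m v) ∈ K := inW_delta_mem_of_isCoatom hK
  have hmem : ∀ u : U p m, (u : U p m ⧸ N) ∈ H → u ∈ K := fun u hu => hHK' hu
  have hp' : b₀ p m ^ p ∈ K := isPGroup_U.pow_mem_of_isCoatom hK _
  -- Modulo p-th powers and commutators, which lie in K, the given element is a₀^c with p ∤ c.
  have ha : a₀ p m ∈ K := by
    have h1 := hmem _ hg
    obtain ⟨d, rfl⟩ := hj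
    rw [pow_mul, K.mul_mem_cancel_right (K.pow_mem hp' d), inW_add,
      K.mul_mem_cancel_right (hd v), inW_nsmul] at h1
    exact isPGroup_U.mem_of_pow_mem hc h1
  -- If b₀ ∉ K, then K contains only elements with b₀-exponent divisible by p, so H lies in the
  -- image of the abelian group W⟨b₀^p⟩.
  refine hK.1 (eq_top_of_mem ha ?_ hd)
  by_contra hb
  refine hnc (Subgroup.isMulCommutative_iff_forall_mem.2 fun x hx y hy => ?_)
  have key : ∀ x ∈ H, ∃ (w : AddW p m) (i : ℕ), p ∣ i ∧
      x = ((inW w * b₀ p m ^ i : U p m) : U p m ⧸ N) := by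
    intro x hx
    obtain ⟨u, rfl⟩ := QuotientGroup.mk_surjective x
    obtain ⟨w, i, rfl⟩ := exists_eq_inW_mul_b₀_pow u
    refine ⟨w, i, ?_, rfl⟩
    by_contra hi
    apply hb
    have h1 := hmem _ hx
    have hw : inW w ∈ K := by
      obtain ⟨c', v', rfl⟩ := exists_eq_add_delta w
      rw [inW_add, inW_nsmul]
      exact K.mul_mem (K.pow_mem ha _) (hd _)
    rw [K.mul_mem_cancel_left hw] at h1
    exact isPGroup_U.mem_of_pow_mem hi h1
  obtain ⟨w, i, hi, rfl⟩ := key x hx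
  obtain ⟨w', i', hi', rfl⟩ := key y hy
  rw [← QuotientGroup.mk_mul, ← QuotientGroup.mk_mul, (commute_of_dvd w w' hi hi').eq]

theorem not_isMulCommutative_quotient (h : ¬ commutator (U p m) ≤ N) :
    ¬ IsMulCommutative (U p m ⧸ N) := fun hc => h <| by
  rwa [← Subgroup.Normal.quotient_commutative_iff_commutator_le]

theorem quotient_of_mem_family (hm : 2 ≤ m) (hN : N ∈ family p m) :
    ¬ IsMulCommutative (U p m ⧸ N) ∧ IsPGroup p (U p m ⧸ N) ∧
      IsExponentCritical (U p m ⧸ N) ∧ Monoid.exponent (U p m ⧸ N) = p ^ m := by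
  obtain ⟨-, hD, -, hint, hcomm⟩ := hN
  have hexp := exponent_quotient hm hD hint
  exact ⟨not_isMulCommutative_quotient hcomm, isPGroup_U.to_quotient N,
    isExponentCritical_of_forall_pow_eq_one (by omega) hexp fun H hH hnc g hg =>
      pow_eq_one_of_ne_top hm hD hH hnc hg, hexp⟩

/-- By the generator of `D`, it suffices that a_{p−1}^(p^(m−2)) ∈ N. For p ≥ 3, a_{p−1} =
`delta`^(p−1) a₀ is an iterate of `delta`² a₀; for p = 2 and m ≥ 3 the element is a power of
`delta`(2a₀). -/
theorem a₀_pow_mem_of_delta_mem (hpm : Odd p ∨ 3 ≤ m) (hD : D p m ≤ N)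
    (h1 : inW (delta p m (delta p m (gen₀ p m))) ∈ N)
    (h2 : inW (delta p m (p • gen₀ p m)) ∈ N) : a₀ p m ^ p ^ (m - 1) ∈ N := by
  have hDmem : a₀ p m ^ p ^ (m - 1) * aLast p m ^ p ^ (m - 2) ∈ N :=
    hD (Subgroup.mem_zpowers _)
  refine (N.mul_mem_cancel_right ?_).1 hDmem
  have hlast : aLast p m = inW ((delta p m ^ (p - 1)) (gen₀ p m)) := by
    rw [delta_pow_gen₀ (p - 1) (Nat.sub_lt hp.out.pos one_pos)]
    rfl
  have hstep : ∀ w : AddW p m, inW w ∈ N → inW (delta p m w) ∈ N := by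
    intro w hw
    rw [inW_delta]
    refine N.mul_mem ?_ (N.inv_mem hw)
    simpa using (inferInstance : N.Normal).conj_mem _ hw (b₀ p m)⁻¹
  have hiter : ∀ (n : ℕ) (w : AddW p m), inW w ∈ N → inW ((delta p m ^ n) w) ∈ N := by
    intro n w hw
    induction n with
    | zero => exact hw
    | succ n ih => rw [pow_succ', Module.End.mul_apply]; exact hstep _ ih
  by_cases h3 : 3 ≤ p
  · obtain ⟨q, hq⟩ := Nat.exists_eq_add_of_le' h3
    refine N.pow_mem ?_ _
    rw [hlast, show p - 1 = q + 1 + 1 by omega, pow_succ, pow_succ, Module.End.mul_apply,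
      Module.End.mul_apply]
    exact hiter q _ h1
  · have hp2 : p = 2 := le_antisymm (by omega) hp.out.two_le
    have hm3 : 3 ≤ m := hpm.resolve_left (by rw [hp2]; decide)
    rw [show m - 2 = m - 3 + 1 by omega, pow_succ', pow_mul, hlast, ← inW_nsmul]
    refine N.pow_mem ?_ _
    rw [show p - 1 = 1 by omega, pow_one, ← map_nsmul]
    exact h2

theorem isTypeA_quotient (hm : 2 ≤ m) (hpm : Odd p ∨ 3 ≤ m) (hN : N ∈ family p m) :
    IsTypeA (U p m ⧸ N) := by
  obtain ⟨-, hD, hfr, hint, hcomm⟩ := hN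
  have hbot : IsCoatom (⊥ : Subgroup (Multiplicative (ZMod p))) := by
    have : IsSimpleGroup (Multiplicative (ZMod p)) := isSimpleGroup_of_prime_card (p := p) (by simp)
    exact isCoatom_bot
  have hker : N ≤ (bChar (p := p) hm).ker := hfr.trans (frattini_le_coatom
    (Subgroup.isCoatom_comap_of_surjective (bChar_surjective hm) hbot))
  let χ : U p m ⧸ N →* Multiplicative (ZMod p) := QuotientGroup.lift N (bChar hm) hker
  have hχ : IsCoatom χ.ker := Subgroup.isCoatom_comap_of_surjective
    (QuotientGroup.lift_surjective_of_surjective N _ (bChar_surjective hm) hker) hbot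
  have hmemχ : ∀ (w : AddW p m) (j : ℕ),
      ((inW w * b₀ p m ^ j : U p m) : U p m ⧸ N) ∈ χ.ker ↔ p ∣ j :=
    fun w j => mem_ker_bChar hm w j
  have hcχ : ∀ x ∈ χ.ker, ∀ y ∈ χ.ker, x * y = y * x := by
    intro x hx y hy
    obtain ⟨u, rfl⟩ := QuotientGroup.mk_surjective x
    obtain ⟨u', rfl⟩ := QuotientGroup.mk_surjective y
    obtain ⟨w, i, rfl⟩ := exists_eq_inW_mul_b₀_pow u
    obtain ⟨w', i', rfl⟩ := exists_eq_inW_mul_b₀_pow u'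
    rw [← QuotientGroup.mk_mul, ← QuotientGroup.mk_mul,
      (commute_of_dvd w w' ((hmemχ _ _).1 hx) ((hmemχ _ _).1 hy)).eq]
  refine ⟨χ.ker, ⟨hχ, Subgroup.isMulCommutative_iff_forall_mem.2 hcχ⟩, ?_⟩
  rintro K ⟨hK, hcK⟩
  rw [Subgroup.isMulCommutative_iff_forall_mem] at hcK
  by_contra hne
  have htop : χ.ker ⊔ K = ⊤ := hχ.sup_eq_top_of_ne hK (Ne.symm hne)
  -- An element of two distinct abelian maximal subgroups is centralised by their join, the whole
  -- group. Applied to `delta` a₀ and p·a₀, commuting with b₀ puts their `delta`-images in N.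
  have hcen : ∀ x ∈ χ.ker, x ∈ K → ∀ y, x * y = y * x := by
    intro x hx hx' y
    have hle : χ.ker ⊔ K ≤ Subgroup.centralizer {x} := by
      refine sup_le (fun z hz => ?_) fun z hz => ?_
      · exact Subgroup.mem_centralizer_singleton_iff.2 (hcχ z hz x hx)
      · exact Subgroup.mem_centralizer_singleton_iff.2 (hcK z hz x hx')
    have hy : y ∈ Subgroup.centralizer {x} := hle (htop ▸ Subgroup.mem_top y)
    exact (Subgroup.mem_centralizer_singleton_iff.1 hy).symm
  have hKU := Subgroup.isCoatom_comap_of_surjective (QuotientGroup.mk'_surjective N) hK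
  have hmemN : ∀ w : AddW p m, ((inW w : U p m) : U p m ⧸ N) ∈ K → inW (delta p m w) ∈ N := by
    intro w hw
    have hw' : ((inW w : U p m) : U p m ⧸ N) ∈ χ.ker := by
      simpa using (hmemχ w 0).2 (dvd_zero p)
    have hc := hcen _ hw' hw (b₀ p m : U p m ⧸ N)
    rw [← QuotientGroup.eq_one_iff, inW_delta]
    simp only [QuotientGroup.mk_mul, QuotientGroup.mk_inv]
    rw [mul_assoc _ _ (b₀ p m : U p m ⧸ N), hc]
    group
  refine a₀_pow_notMem (by omega) hint (a₀_pow_mem_of_delta_mem hpm hD ?_ ?_)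
  · exact hmemN _ (inW_delta_mem_of_isCoatom hKU _)
  · refine hmemN _ ?_
    rw [inW_nsmul]
    exact isPGroup_U.pow_mem_of_isCoatom hKU _

end Quotient

end TypeA

/-! ### The universal property of W and U -/

namespace TypeA

variable {p m : ℕ}

theorem exists_linearMap_of_nsmul_eq_zero {V : Type*} [AddCommGroup V] (y : Fin p → V)
    (hy : ∀ i, ord p m i • y i = 0) :
    ∃ F : AddW p m →ₗ[ℤ] V, ∀ i, F (gen p m i) = y i := by
  have hy' : ∀ i, zmultiplesHom V (y i) (ord p m i) = 0 := fun i => by simpa using hy i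
  refine ⟨∑ i : Fin p, (ZMod.lift (ord p m i) ⟨zmultiplesHom V (y i), hy' i⟩).toIntLinearMap ∘ₗ
    LinearMap.proj i, fun i => ?_⟩
  rw [LinearMap.sum_apply, Finset.sum_eq_single i]
  · have h := ZMod.lift_coe (ord p m i) ⟨zmultiplesHom V (y i), hy' i⟩ 1
    simpa [gen] using h
  · intro j _ hj
    simp [gen, Pi.single_eq_of_ne hj]
  · simp

theorem linearMap_ext {V : Type*} [AddCommGroup V] {f g : AddW p m →ₗ[ℤ] V}
    (h : ∀ i, f (gen p m i) = g (gen p m i)) : f = g := by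
  refine LinearMap.pi_ext fun i x => ?_
  obtain ⟨k, rfl⟩ := ZMod.intCast_surjective x
  have : (Pi.single i (k : ZMod (ord p m i)) : AddW p m) = k • gen p m i := by
    rw [gen, ← Pi.single_smul, zsmul_one]
  rw [this, map_zsmul, map_zsmul, h]

variable [hp : Fact p.Prime]

/-- `W` is the universal abelian group with an automorphism `σ` of order dividing `p` and an
element `x` of order dividing `p ^ m` such that the order of `σ x - x` divides `p ^ (m - 1)`. -/
theorem exists_linearMap_addPhi {V : Type*} [AddCommGroup V] (σ : Module.End ℤ V)
    (hσ : σ ^ p = 1) (x : V) (hx : p ^ m • x = 0) (hx' : p ^ (m - 1) • (σ x - x) = 0) :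
    ∃ F : AddW p m →ₗ[ℤ] V, F (gen₀ p m) = x ∧ ∀ w, F (addPhi p m w) = σ (F w) := by
  -- As a_i = `delta`^i a₀, the map must send a_i to κ^i x with κ = σ − 1.
  obtain ⟨κ, hκ⟩ : ∃ κ : Module.End ℤ V, σ = κ + 1 := ⟨σ - 1, by simp⟩
  have hκx : κ x = σ x - x := by simp [hκ]
  obtain ⟨F, hF⟩ := exists_linearMap_of_nsmul_eq_zero (m := m) (fun i : Fin p => (κ ^ i.val) x)
    fun i => by
      unfold ord
      split_ifs with h
      · simpa [h] using hx
      · obtain ⟨j, hj⟩ := Nat.exists_eq_succ_of_ne_zero h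
        rw [hj, pow_succ, Module.End.mul_apply, hκx, ← map_nsmul, hx', map_zero]
  refine ⟨F, by rw [gen₀, hF]; rfl, fun w => ?_⟩
  suffices h : F ∘ₗ addPhi p m = σ ∘ₗ F from LinearMap.congr_fun h w
  refine linearMap_ext fun i => ?_
  rw [LinearMap.comp_apply, LinearMap.comp_apply, addPhi_gen, img]
  have hsucc : σ (F (gen p m i)) = F (gen p m i) + (κ ^ (i.val + 1)) x := by
    rw [hF, hκ, LinearMap.add_apply, pow_succ', Module.End.mul_apply, Module.End.one_apply,
      add_comm]
  rw [hsucc]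
  split_ifs with h
  · rw [map_add, hF ⟨i.val + 1, h⟩]
  · rw [map_add, map_sum, show i.val + 1 = p by omega]
    congr 1
    -- Expanding (1 + κ)^p = 1 expresses κ^p x exactly as the definition of φ(a_{p−1}) requires.
    have hbin : ∑ j : Fin p, p.choose j.val • (κ ^ j.val) x + (κ ^ p) x = x := by
      have h1 := LinearMap.congr_fun hσ x
      rw [hκ, (Commute.one_right κ).add_pow, LinearMap.sum_apply, Finset.sum_range_succ,
        Finset.sum_range] at h1
      have hterm : ∀ j : ℕ, (κ ^ j * 1 ^ (p - j) * (p.choose j : Module.End ℤ V)) x =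
          p.choose j • (κ ^ j) x := fun j => by
        rw [one_pow, mul_one, Module.End.mul_apply, Module.End.natCast_apply, map_nsmul]
      simp only [hterm] at h1
      simpa only [Nat.choose_self, one_smul, Module.End.one_apply] using h1
    have hsplit : ∑ j : Fin p, p.choose j.val • (κ ^ j.val) x =
        x + ∑ j : Fin p with j.val ≠ 0, p.choose j.val • (κ ^ j.val) x := by
      rw [← Finset.sum_filter_add_sum_filter_not Finset.univ (fun j : Fin p => j.val = 0)]
      congr 1
      rw [Finset.sum_eq_single ⟨0, hp.out.pos⟩]
      · simp
      · exact fun b hb hb' => absurd (Fin.ext (Finset.mem_filter.1 hb).2) hb'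
      · simp
    rw [hsplit, add_assoc, add_eq_left] at hbin
    rw [← neg_eq_of_add_eq_zero_right hbin, ← Finset.sum_neg_distrib]
    exact Finset.sum_congr rfl fun j _ => by rw [map_neg, map_nsmul, hF]

open scoped IsMulCommutative in
-- The universal property of `W` is applied to M with conjugation by b⁻¹, whose p-th power is
-- trivial because b^p centralises M. The resulting map on `W` extends over ⟨b₀⟩ once compatibility
-- is checked for b₀ itself.
theorem exists_monoidHom_U {G : Type*} [Group G] (M : Subgroup G) [M.Normal]
    [IsMulCommutative M] {x b : G} (hxM : x ∈ M) (hb : b ^ p ^ (m - 1) = 1)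
    (hbp : ∀ y ∈ M, b ^ p * y = y * b ^ p) (hx : x ^ p ^ m = 1)
    (hxb : (b⁻¹ * x * b * x⁻¹) ^ p ^ (m - 1) = 1) :
    ∃ f : U p m →* G, f (a₀ p m) = x ∧ f (b₀ p m) = b ∧ ∀ w, f (inW w) ∈ M := by
  let σ : Module.End ℤ (Additive M) :=
    (MonoidHom.toAdditive (MulAut.conjNormal b⁻¹ : MulAut M).toMonoidHom).toIntLinearMap
  have hσ : ∀ y : Additive M, ((σ y).toMul : G) = b⁻¹ * (y.toMul : G) * b := fun y => by
    have := MulAut.conjNormal_apply b⁻¹ y.toMul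
    rw [inv_inv] at this
    exact this
  have hσn : ∀ (n : ℕ) (y : Additive M),
      (((σ ^ n) y).toMul : G) = (b ^ n)⁻¹ * (y.toMul : G) * b ^ n := by
    intro n y
    induction n with
    | zero => simp
    | succ n ih =>
      rw [pow_succ', Module.End.mul_apply, hσ, ih, pow_succ]
      group
  have hσp : σ ^ p = 1 := LinearMap.ext fun y => by
    refine Additive.toMul.injective (Subtype.ext ?_)
    rw [hσn, mul_assoc, ← hbp _ y.toMul.2, inv_mul_cancel_left]
    rfl
  obtain ⟨F, hF0, hF⟩ := exists_linearMap_addPhi (m := m) σ hσp (Additive.ofMul ⟨x, hxM⟩)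
    (Additive.toMul.injective (Subtype.ext (by simpa using hx)))
    (Additive.toMul.injective (Subtype.ext (by
      have h2 := hσ (Additive.ofMul ⟨x, hxM⟩)
      simp only [toMul_ofMul] at h2
      simpa [toMul_sub, div_eq_mul_inv, h2] using hxb)))
  let fn : W p m →* G := M.subtype.comp (AddMonoidHom.toMultiplicativeLeft F.toAddMonoidHom)
  have hfn : ∀ w : AddW p m, fn (Multiplicative.ofAdd w) = ((F w).toMul : G) := fun _ => rfl
  let fb : B p m →* G := AddMonoidHom.toMultiplicativeLeft (ZMod.lift (p ^ (m - 1))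
    ⟨zmultiplesHom (Additive G) (Additive.ofMul b), by
      rw [zmultiplesHom_apply, ← ofMul_zpow, zpow_natCast, hb, ofMul_one]⟩)
  have hfb : fb (Multiplicative.ofAdd 1) = b := by
    have h := congrArg Additive.toMul (ZMod.lift_coe (p ^ (m - 1))
      ⟨zmultiplesHom (Additive G) (Additive.ofMul b), by
        rw [zmultiplesHom_apply, ← ofMul_zpow, zpow_natCast, hb, ofMul_one]⟩ 1)
    simpa [fb] using h
  have hone : ∀ w, fn (act p m (Multiplicative.ofAdd 1) w) = b * fn w * b⁻¹ := by
    intro w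
    rw [act_ofAdd_one]
    obtain ⟨v, rfl⟩ := (phi p m).surjective w
    have h1 : fn (phi p m v) = b⁻¹ * fn v * b := by
      have h2 : phi p m v = Multiplicative.ofAdd (addPhi p m v.toAdd) := rfl
      rw [h2, hfn, hF, hσ]
      rfl
    rw [MulAut.inv_apply_self, h1]
    group
  have hcompat : ∀ (j : ℕ) w, fn (act p m (Multiplicative.ofAdd 1 ^ j) w) =
      b ^ j * fn w * (b ^ j)⁻¹ := by
    intro j
    induction j with
    | zero => simp
    | succ j ih =>
      intro w
      rw [pow_succ, map_mul, MulAut.mul_apply, ih, hone]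
      group
  have hgen : ∀ g : B p m, ∃ j : ℕ, g = Multiplicative.ofAdd 1 ^ j := fun g =>
    ⟨g.toAdd.val, by rw [← ofAdd_nsmul, nsmul_one, ZMod.natCast_zmod_val]; rfl⟩
  refine ⟨SemidirectProduct.lift fn fb fun g => ?_, ?_, ?_, fun w => ?_⟩
  · obtain ⟨j, rfl⟩ := hgen g
    refine MonoidHom.ext fun w => (hcompat j w).trans ?_
    rw [MonoidHom.comp_apply, map_pow fb, hfb]
    rfl
  · rw [← inW_gen₀, inW, SemidirectProduct.lift_inl, hfn, hF0]
    rfl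
  · rw [b₀, SemidirectProduct.lift_inr, hfb]
  · rw [inW, SemidirectProduct.lift_inl, hfn]
    exact (F w).toMul.2

end TypeA

/-! ### Exponent-critical groups of type A as quotients of U -/

namespace TypeA

variable {p m : ℕ} [hp : Fact p.Prime]

theorem mem_frattini {c j : ℕ} (hc : p ∣ c) (hj : p ∣ j) (v : AddW p m) :
    inW (c • gen₀ p m + delta p m v) * b₀ p m ^ j ∈ frattini (U p m) := by
  simp only [frattini, Order.radical, Subgroup.mem_iInf]
  intro K hK
  obtain ⟨c, rfl⟩ := hc
  obtain ⟨j, rfl⟩ := hj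
  rw [inW_add, inW_nsmul, pow_mul, pow_mul]
  exact K.mul_mem (K.mul_mem (K.pow_mem (isPGroup_U.pow_mem_of_isCoatom hK _) _)
    (inW_delta_mem_of_isCoatom hK v)) (K.pow_mem (isPGroup_U.pow_mem_of_isCoatom hK _) _)

theorem dvd_of_mem_of_isCoatom {K : Subgroup (U p m)} (hK : IsCoatom K) (ha : a₀ p m ∉ K)
    (hb : b₀ p m ∈ K) {c j : ℕ} {v : AddW p m}
    (h : inW (c • gen₀ p m + delta p m v) * b₀ p m ^ j ∈ K) : p ∣ c := by
  by_contra hc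
  rw [K.mul_mem_cancel_right (K.pow_mem hb j), inW_add,
    K.mul_mem_cancel_right (inW_delta_mem_of_isCoatom hK v), inW_nsmul] at h
  exact ha (isPGroup_U.mem_of_pow_mem hc h)

/-- The structure of an exponent-critical `p`-group with exactly one abelian maximal subgroup `M`:
it is an image of `U`, in which the images of `W` and `b₀` lie in `M` and in a non-abelian maximal
subgroup `K`, respectively. -/
theorem exists_surjective {P : Type*} [Group P] (hnc : ¬ IsMulCommutative P) (hP : IsPGroup p P)
    (hcrit : IsExponentCritical P) (hexp : Monoid.exponent P = p ^ m) (hA : IsTypeA P) :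
    2 ≤ m ∧ ∃ (f : U p m →* P) (M K : Subgroup P), Function.Surjective f ∧ D p m ≤ f.ker ∧
      f (a₀ p m) ^ p ^ (m - 1) ≠ 1 ∧ (∀ w, f (inW w) ∈ M) ∧ f (b₀ p m) ∉ M ∧ IsCoatom K ∧
      f (a₀ p m) ∉ K ∧ f (b₀ p m) ∈ K ∧ ¬ IsMulCommutative K := by
  have hfin : Finite P := hcrit.1
  obtain ⟨M, ⟨hM, hMc⟩, hMu⟩ := hA
  have hnorm := hP.normal_of_isCoatom hM
  have hcoatom : ∀ g : P, ∃ K : Subgroup P, IsCoatom K ∧ g ∈ K := by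
    intro g
    rcases eq_top_or_exists_le_coatom (Subgroup.zpowers g) with h | ⟨K, hK, hle⟩
    · refine absurd (isMulCommutative_iff.2 fun y z => ?_) hnc
      obtain ⟨i, rfl⟩ := Subgroup.mem_zpowers_iff.1 (h ▸ Subgroup.mem_top y)
      obtain ⟨j, rfl⟩ := Subgroup.mem_zpowers_iff.1 (h ▸ Subgroup.mem_top z)
      exact (Commute.zpow_zpow_self g i j).eq
    · exact ⟨K, hK, hle (Subgroup.mem_zpowers g)⟩
  have hlow : ∀ K : Subgroup P, IsCoatom K → K ≠ M → ∀ g ∈ K, g ^ p ^ (m - 1) = 1 :=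
    fun K hK hne g hg => hcrit.pow_eq_one hexp hK.1 (fun h => hne (hMu K ⟨hK, h⟩)) hg
  have hout : ∀ g ∉ M, g ^ p ^ (m - 1) = 1 := by
    intro g hg
    obtain ⟨K, hK, hgK⟩ := hcoatom g
    exact hlow K hK (by rintro rfl; exact hg hgK) g hgK
  obtain ⟨b, hb⟩ : ∃ b, b ∉ M := by
    by_contra! h
    exact hM.1 ((Subgroup.eq_top_iff' M).2 h)
  -- For m ≤ 1 the truncated m − 1 is 0, so elements outside M would be trivial.
  have hm : 2 ≤ m := by
    by_contra hlt
    have := hout b hb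
    rw [show m - 1 = 0 by omega, pow_zero, pow_one] at this
    exact hb (this ▸ M.one_mem)
  obtain ⟨x, hx⟩ : ∃ x : P, x ^ p ^ (m - 1) ≠ 1 := by
    by_contra! h
    have hd := Monoid.exponent_dvd_of_forall_pow_eq_one h
    rw [hexp, Nat.pow_dvd_pow_iff_le_right hp.out.one_lt] at hd
    omega
  have hxM : x ∈ M := by
    by_contra h
    exact hx (hout x h)
  obtain ⟨K, hK, hbK⟩ := hcoatom b
  have hKM : K ≠ M := by rintro rfl; exact hb hbK
  have hxK : x ∉ K := fun h => hx (hlow K hK hKM x h)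
  have hMcomm := Subgroup.isMulCommutative_iff_forall_mem.1 hMc
  have hbp : b ^ p ∈ M := hP.pow_mem_of_isCoatom hM b
  obtain ⟨f, hfa, hfb, hfM⟩ := exists_monoidHom_U (m := m) M hxM (hout b hb)
    (fun y hy => hMcomm _ hbp y hy)
    (by rw [← hexp]; exact Monoid.pow_exponent_eq_one x)
    (hlow K hK hKM _ (hP.conj_mul_inv_mem_of_isCoatom hK b x))
  refine ⟨hm, f, M, K, ?_, ?_, hfa ▸ hx, hfM, hfb ▸ hb, hK, hfa ▸ hxK, hfb ▸ hbK,
    fun h => hKM (hMu K ⟨hK, h⟩)⟩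
  -- No maximal subgroup contains the image: M misses b, and the others contain no element of order
  -- p^m.
  · rw [← MonoidHom.range_eq_top]
    by_contra hne
    obtain ⟨L, hL, hle⟩ := (eq_top_or_exists_le_coatom f.range).resolve_left hne
    have hLM : L ≠ M := by
      rintro rfl
      exact hb (hfb ▸ hle ⟨_, rfl⟩)
    exact hx (hlow L hL hLM x (hfa ▸ hle ⟨_, rfl⟩))
  -- The generator of `D` is (a₀b₀⁻¹)^(p^(m−1)), and xb⁻¹ lies outside M.
  · rw [D, Subgroup.zpowers_le, MonoidHom.mem_ker]
    rw [← inW_nsmul_tr_gen₀ hm, ← inW_mul_b₀_inv_pow_pow hm, map_pow, map_mul, map_inv, inW_gen₀,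
      hfa, hfb]
    exact hout _ fun h => hb (M.inv_mem_iff.1 ((M.mul_mem_cancel_left hxM).1 h))

theorem exists_mem_family {P : Type*} [Group P] (hnc : ¬ IsMulCommutative P) (hP : IsPGroup p P)
    (hcrit : IsExponentCritical P) (hexp : Monoid.exponent P = p ^ m) (hA : IsTypeA P) :
    2 ≤ m ∧ ∃ (N : Subgroup (U p m)) (_ : N.Normal), N ∈ family p m ∧
      Nonempty (P ≃* U p m ⧸ N) := by
  obtain ⟨hm, f, M, K, hf, hD, hx, hfM, hbM, hK, haK, hbK, -⟩ :=
    exists_surjective hnc hP hcrit hexp hA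
  have equiv := (QuotientGroup.quotientKerEquivOfSurjective f hf).symm
  refine ⟨hm, f.ker, inferInstance, ⟨inferInstance, hD, fun u hu => ?_, ?_, fun hle => ?_⟩,
    ⟨equiv⟩⟩
  · obtain ⟨w, j, rfl⟩ := exists_eq_inW_mul_b₀_pow u
    obtain ⟨c, v, rfl⟩ := exists_eq_add_delta w
    -- For a kernel element, K (containing b but not x) forces p ∣ c, and M (containing the image of
    -- W but not b) forces p ∣ j.
    refine mem_frattini ?_ ?_ v
    · refine dvd_of_mem_of_isCoatom (Subgroup.isCoatom_comap_of_surjective hf hK) haK hbK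
        (j := j) (v := v) ?_
      rw [Subgroup.mem_comap, MonoidHom.mem_ker.1 hu]
      exact K.one_mem
    · by_contra hj
      have h1 := MonoidHom.mem_ker.1 hu
      rw [map_mul] at h1
      have h2 : f (b₀ p m) ^ j ∈ M := by
        rw [← map_pow, ← M.mul_mem_cancel_left (hfM _), h1]
        exact M.one_mem
      exact hbM (hP.mem_of_pow_mem hj h2)
  · rw [eq_bot_iff]
    rintro u ⟨hu, i, rfl⟩
    have hord : orderOf (f (a₀ p m)) = p ^ (m - 1 + 1) := orderOf_eq_prime_pow hx (by
      rw [Nat.sub_add_cancel (by omega), ← hexp]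
      exact Monoid.pow_exponent_eq_one _)
    have h1 : f (a₀ p m) ^ i = 1 := by rw [← map_zpow]; exact hu
    rw [← orderOf_dvd_iff_zpow_eq_one, hord, Nat.sub_add_cancel (by omega)] at h1
    obtain ⟨d, rfl⟩ := h1
    rw [Subgroup.mem_bot]
    change a₀ p m ^ (((p ^ m : ℕ) : ℤ) * d) = 1
    rw [zpow_mul, zpow_natCast, ← inW_gen₀, ← inW_nsmul, pow_nsmul_eq_zero, inW_zero, one_zpow]
  · apply hnc
    have h1 := (Subgroup.Normal.quotient_commutative_iff_commutator_le).2 hle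
    refine isMulCommutative_iff.2 fun y z => equiv.injective ?_
    rw [map_mul, map_mul]
    exact isMulCommutative_iff.1 h1 _ _

theorem not_isTypeA_two {P : Type*} [Group P] (hnc : ¬ IsMulCommutative P) (hP : IsPGroup 2 P)
    (hcrit : IsExponentCritical P) (hexp : Monoid.exponent P = 2 ^ 2) : ¬ IsTypeA P := by
  intro hA
  obtain ⟨-, f, M, K, hf, hD, hx, hfM, hbM, hK, haK, hbK, hKc⟩ :=
    exists_surjective hnc hP hcrit hexp hA
  apply hKc
  -- Here `tr` = 2 + `delta` kills `delta` w, and 2·`delta` w = 0.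
  have hdd : ∀ w : AddW 2 2, delta 2 2 (delta 2 2 w) = 0 := by
    intro w
    have h := tr_delta w
    rw [tr, sum_addPhi_pow] at h
    have h2 := nsmul_delta w
    simp only [Finset.sum_range_succ, Finset.sum_range_zero, zero_add, LinearMap.add_apply,
      LinearMap.smul_apply, pow_zero, pow_one, Module.End.one_apply, Nat.choose_one_right,
      Nat.choose_self, one_smul] at h
    rw [show 2 ^ (2 - 1) = 2 from rfl] at h2
    rwa [h2, zero_add] at h
  -- K omits the image of a₀, so c is even and `delta` kills the W-part, which therefore commutes
  -- with b₀. This makes K abelian.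
  have key : ∀ y ∈ K, ∃ (w : AddW 2 2) (j : ℕ), delta 2 2 w = 0 ∧ y = f (inW w * b₀ 2 2 ^ j) := by
    intro y hy
    obtain ⟨u, rfl⟩ := hf y
    obtain ⟨w, j, rfl⟩ := exists_eq_inW_mul_b₀_pow u
    obtain ⟨c, v, rfl⟩ := exists_eq_add_delta w
    obtain ⟨d, rfl⟩ := dvd_of_mem_of_isCoatom (Subgroup.isCoatom_comap_of_surjective hf hK)
      haK hbK hy
    refine ⟨_, j, ?_, rfl⟩
    rw [map_add, hdd, add_zero, mul_comm, mul_smul, map_nsmul, map_nsmul]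
    exact (congrArg (d • ·) (nsmul_delta (gen₀ 2 2))).trans (smul_zero d)
  refine Subgroup.isMulCommutative_iff_forall_mem.2 fun y hy z hz => ?_
  obtain ⟨v, i, hv, rfl⟩ := key y hy
  obtain ⟨w, j, hw, rfl⟩ := key z hz
  rw [← map_mul, ← map_mul]
  congr 1
  exact (((inW_comm v w).mul_right ((commute_b₀_inW hv).symm.pow_right j)).mul_left
    (((commute_b₀_inW hw).pow_left i).mul_right (Commute.pow_pow_self _ _ _))).eq

end TypeA

theorem theoremE (p : ℕ) [Fact p.Prime] (m : ℕ) :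
    (∀ (P : Type*) [Group P], ¬ IsMulCommutative P → IsPGroup p P → IsExponentCritical P →
        Monoid.exponent P = p ^ m → IsTypeA P →
        2 ≤ m ∧ ∃ (N : Subgroup (TypeA.U p m)) (_ : N.Normal),
          N ∈ TypeA.family p m ∧ Nonempty (P ≃* TypeA.U p m ⧸ N)) ∧
    (2 ≤ m → ∀ (N : Subgroup (TypeA.U p m)) [N.Normal], N ∈ TypeA.family p m →
        ¬ IsMulCommutative (TypeA.U p m ⧸ N) ∧ IsPGroup p (TypeA.U p m ⧸ N) ∧
        IsExponentCritical (TypeA.U p m ⧸ N) ∧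
        Monoid.exponent (TypeA.U p m ⧸ N) = p ^ m) ∧
    (∀ (P : Type*) [Group P], ¬ (¬ IsMulCommutative P ∧ IsPGroup 2 P ∧ IsExponentCritical P ∧
        Monoid.exponent P = 2 ^ 2 ∧ IsTypeA P)) ∧
    (2 ≤ m → (Odd p ∨ 3 ≤ m) → ∀ (N : Subgroup (TypeA.U p m)) [N.Normal],
        N ∈ TypeA.family p m →
        ¬ IsMulCommutative (TypeA.U p m ⧸ N) ∧ IsPGroup p (TypeA.U p m ⧸ N) ∧
        IsExponentCritical (TypeA.U p m ⧸ N) ∧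
        Monoid.exponent (TypeA.U p m ⧸ N) = p ^ m ∧ IsTypeA (TypeA.U p m ⧸ N)) := by
  refine ⟨fun P _ hnc hP hcrit hexp hA => TypeA.exists_mem_family hnc hP hcrit hexp hA,
    fun hm N _ hN => TypeA.quotient_of_mem_family hm hN,
    fun P _ ⟨hnc, hP, hcrit, hexp, hA⟩ => TypeA.not_isTypeA_two hnc hP hcrit hexp hA,
    fun hm hpm N _ hN => ?_⟩
  obtain ⟨h1, h2, h3, h4⟩ := TypeA.quotient_of_mem_family hm hN
  exact ⟨h1, h2, h3, h4, TypeA.isTypeA_quotient hm hpm hN⟩
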